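/- **Definitions.** For measurable $f:\mathbb{R}^n\to\{0,1\}$ let $\mathrm{Vol}(f)=\Pr_{x\sim N(0,I_n)}[f(x)=1]$; when $\mathrm{Vol}(f)>0$ let $\mathrm{SAMP}(f)$ be the distribution $N(0,I_n)$ conditioned on $f^{-1}(1)$, and for $g:\mathbb{R}^n\to\{0,1\}$ let $\mathrm{rel\text{-}dist}(f,g)=\mathrm{Vol}(f^{-1}(1)\,\triangle\,g^{-1}(1))/\mathrm{Vol}(f)$. An LTF (halfspace) over $\mathbb{R}^n$ is a function $x\mapsto \mathbf 1[w\cdot x-\theta\ge 0]$ with $w\in\mathbb{R}^n$ (possibly $w=0$) and $\theta\in\mathbb{R}$. A sample-only algorithm is a randomized algorithm whose only access to the unknown $f$ is through independent draws from $\mathrm{SAMP}(f)$ (in particular it has no black-box access to $f$ and is not given an estimate of $\mathrm{Vol}(f)$); it may decide adaptively, from its internal randomness and the samples seen so far, whether to draw another sample or to halt and answer "yes" or "no". It is a relative-error $\varepsilon$-tester for LTFs over $N(0,I_n)$ under the guarantee $f\in\mathcal G$ if for every measurable $f\in\mathcal G$: it answers "yes" with probability at least $9/10$ if $f$ is an LTF,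 and answers "no" with probability at least $9/10$ if $\inf_{g\text{ an LTF}}\mathrm{rel\text{-}dist}(f,g)\ge\varepsilon$. **Theorem.** Any sample-only relative-error $0.1$-tester for LTFs over $N(0,I_n)$ must use $\Omega(n)$ samples, even under the guarantee that $\mathrm{Vol}(f)\in\{1/2,1\}$. That is, there is an absolute constant $c>0$ such that for every $n$, every sample-only algorithm $A$ over $\mathbb{R}^n$ that is a relative-error $0.1$-tester for LTFs over $N(0,I_n)$ under the guarantee $\mathrm{Vol}(f)\in\{1/2,1\}$, and every $m\in\mathbb{N}$: if, for every measurable $f$ with $\mathrm{Vol}(f)\in\{1/2,1\}$, $A$ draws at most $m$ samples on $f$ almost surely, then $m\ge c\,n$. -/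

import Mathlib

open MeasureTheory ProbabilityTheory
open scoped ENNReal

universe u

/-- Euclidean space `ℝⁿ`. -/
abbrev RSpace (n : ℕ) : Type := EuclideanSpace ℝ (Fin n)

/-- A `0/1`-valued function on `ℝⁿ` (`true` stands for `1`, `false` for `0`). -/
abbrev BoolFun (n : ℕ) : Type := RSpace n → Bool

/-- The set `f⁻¹(1)`. -/
def ones {n : ℕ} (f : BoolFun n) : Set (RSpace n) := {x | f x = true}

/-- The Gaussian volume `Vol(f) = Pr_{x ∼ N(0, I_n)}[f(x) = 1]`. -/
noncomputable def gaussVol {n : ℕ} (f : BoolFun n) : ℝ≥0∞ :=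
  stdGaussian (RSpace n) (ones f)

/-- The relative distance `Vol(f⁻¹(1) △ g⁻¹(1)) / Vol(f)`. -/
noncomputable def relDist {n : ℕ} (f g : BoolFun n) : ℝ≥0∞ :=
  stdGaussian (RSpace n) (symmDiff (ones f) (ones g)) / gaussVol f

/-- The relative distance from `f` to a class `C` of functions. -/
noncomputable def relDistClass {n : ℕ} (f : BoolFun n) (C : Set (BoolFun n)) : ℝ≥0∞ :=
  ⨅ g ∈ C, relDist f g

/-- The class of linear threshold functions (halfspaces) `x ↦ 𝟙[w · x - θ ≥ 0]`. The weight
vector `w` may be zero, so both constant functions belong to the class. -/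
def LTF (n : ℕ) : Set (BoolFun n) :=
  {f | ∃ (w : RSpace n) (θ : ℝ), ∀ x, f x = true ↔ 0 ≤ inner ℝ w x - θ}

/-- The distribution of one call to the oracle `SAMP(f)`: the standard Gaussian conditioned on
`f⁻¹(1)`. -/
noncomputable def SAMP {n : ℕ} (f : BoolFun n) : Measure (RSpace n) :=
  ProbabilityTheory.cond (stdGaussian (RSpace n)) (ones f)

/-- A randomized sample-only algorithm over `ℝⁿ`. It draws a random seed once; after each number
`k` of samples it looks at the seed and at the `k` samples drawn so far, and either asks for one
more sample (`none`) or halts with an answer (`some true` is "yes", `some false` is "no"). So the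
number of samples may be chosen adaptively, and the samples are the only access to the unknown
function. -/
structure SampleAlgorithm (n : ℕ) where
  Seed : Type u
  seedSpace : MeasurableSpace Seed
  seedLaw : Measure Seed
  seedProb : IsProbabilityMeasure seedLaw
  step : (k : ℕ) → Seed → (Fin k → RSpace n) → Option Bool
  measurable_step : ∀ (k : ℕ) (o : Option Bool),
    MeasurableSet {p : Seed × (Fin k → RSpace n) | step k p.1 p.2 = o}

namespace SampleAlgorithm

variable {n : ℕ} (A : SampleAlgorithm.{u} n)

instance : MeasurableSpace A.Seed := A.seedSpace

instance : IsProbabilityMeasure A.seedLaw := A.seedProb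

/-- What the algorithm does after `k` samples, on a seed and an infinite stream of samples. -/
def stepOn (r : A.Seed × (ℕ → RSpace n)) (k : ℕ) : Option Bool :=
  A.step k r.1 (fun i : Fin k => r.2 i)

/-- The algorithm halts with answer `b` (no answer is given on a run that never halts). -/
def Outputs (r : A.Seed × (ℕ → RSpace n)) (b : Bool) : Prop :=
  ∃ k : ℕ, (∀ j < k, A.stepOn r j = none) ∧ A.stepOn r k = some b

/-- The number of samples that the algorithm draws before it halts (`⊤` if it never halts). -/
noncomputable def samplesUsed (r : A.Seed × (ℕ → RSpace n)) : ℕ∞ :=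
  ⨅ (k : ℕ) (_ : A.stepOn r k ≠ none), (k : ℕ∞)

/-- The law of a run on `f`: a random seed and, independently, an i.i.d. stream of draws from
`SAMP(f)`. -/
noncomputable def runLaw (f : BoolFun n) : Measure (A.Seed × (ℕ → RSpace n)) :=
  A.seedLaw.prod (Measure.infinitePi (fun _ : ℕ => SAMP f))

/-- `A` is a relative-error `ε`-testing algorithm for the class `C` over `N(0, I_n)` under the
guarantee that the unknown measurable function belongs to `G`: it says "yes" with probability at
least `9/10` if `f ∈ C`, and "no" with probability at least `9/10` if `f` has relative distance at
least `ε` from `C`. -/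
def IsRelErrorTester (ε : ℝ≥0∞) (C G : Set (BoolFun n)) : Prop :=
  ∀ f : BoolFun n, Measurable f → f ∈ G →
    (f ∈ C → 9 / 10 ≤ A.runLaw f {r | A.Outputs r true}) ∧
    (ε ≤ relDistClass f C → 9 / 10 ≤ A.runLaw f {r | A.Outputs r false})

/-- On every measurable function in `G`, almost every run draws at most `m` samples. -/
def UsesAtMost (G : Set (BoolFun n)) (m : ℕ) : Prop :=
  ∀ f : BoolFun n, Measurable f → f ∈ G → ∀ᵐ r ∂(A.runLaw f), A.samplesUsed r ≤ (m : ℕ∞)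

end SampleAlgorithm

/-- The functions of Gaussian volume `1/2` or `1`. -/
def volHalfOrOne (n : ℕ) : Set (BoolFun n) :=
  {f | gaussVol f = 1 / 2 ∨ gaussVol f = 1}

/-! The constant 1 is a halfspace (take `w = 0`), and its samples are plain Gaussians. Choose `τ` so
that `|x| ≤ τ` has Gaussian mass 1/2. The resulting signs have mean zero, so their products over the
`2^n - 1` nonempty sets of coordinates form an orthonormal family of even, mean-zero `±1` functions.
The region where such a parity is 1 has volume 1/2 and, being even, is far from every halfspace
(`half_le_relDistClass_LTF`).

Conditioning `m` draws on a parity `χ` has likelihood ratio `∏ (1 + χ(x i))`. Averaged over all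
parities, the ratio has variance `(2^m - 1)/(2^n - 1)` by orthonormality
(`integral_sq_one_sub_average_likelihood`), at most 1/2 when `m < n`. A tester accepting plain
Gaussians with probability 9/10 then accepts some parity with probability above 1/10
(`exists_tenth_lt_integral_likelihood`). Hence `n ≤ m`, and `c = 1` works. -/

/-! ### A balanced band on the line and its sign. -/

/-- Some symmetric interval has standard Gaussian mass `1/2`. -/
theorem exists_gaussianReal_Icc_neg_self_eq_half :
    ∃ τ : ℝ, (gaussianReal 0 1).real (Set.Icc (-τ) τ) = 1 / 2 := by
  have hint := integrable_gaussianPDFReal 0 1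
  have hcont : Continuous fun t : ℝ => ∫ x in (-t)..t, gaussianPDFReal 0 1 x := by
    have h0 := intervalIntegral.continuous_primitive
      (fun a b => hint.intervalIntegrable (a := a) (b := b)) 0
    have h1 : (fun t : ℝ => ∫ x in (-t)..t, gaussianPDFReal 0 1 x) = fun t =>
        (∫ x in (0 : ℝ)..t, gaussianPDFReal 0 1 x) - ∫ x in (0 : ℝ)..(-t), gaussianPDFReal 0 1 x := by
      funext t
      exact (intervalIntegral.integral_interval_sub_left hint.intervalIntegrable
        hint.intervalIntegrable).symm
    rw [h1]
    exact h0.sub (h0.comp continuous_neg)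
  have hlim : Filter.Tendsto (fun t : ℝ => ∫ x in (-t)..t, gaussianPDFReal 0 1 x)
      Filter.atTop (nhds 1) := by
    have := intervalIntegral_tendsto_integral hint Filter.tendsto_neg_atTop_atBot
      (Filter.tendsto_id (α := ℝ) (x := Filter.atTop))
    rwa [integral_gaussianPDFReal_eq_one 0 one_ne_zero] at this
  obtain ⟨b, hb, hb0⟩ := ((hlim.eventually (lt_mem_nhds (by norm_num : (1 / 2 : ℝ) < 1))).and
    (Filter.eventually_ge_atTop 0)).exists
  obtain ⟨τ, hτ, h⟩ := intermediate_value_Icc hb0 hcont.continuousOn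
    (show (1 / 2 : ℝ) ∈ _ from ⟨by simp, hb.le⟩)
  refine ⟨τ, ?_⟩
  replace h : ∫ x in (-τ)..τ, gaussianPDFReal 0 1 x = 1 / 2 := h
  have hle : -τ ≤ τ := by linarith [hτ.1]
  rw [measureReal_def, gaussianReal_apply_eq_integral 0 one_ne_zero,
    integral_Icc_eq_integral_Ioc, ← intervalIntegral.integral_of_le hle, h]
  norm_num

/-- The sign `±1` that tells whether `|x| ≤ τ`. -/
noncomputable def bandSign (τ x : ℝ) : ℝ := if |x| ≤ τ then 1 else -1

theorem measurable_bandSign (τ : ℝ) : Measurable (bandSign τ) :=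
  Measurable.ite (measurableSet_le (by fun_prop) (by fun_prop)) measurable_const measurable_const

theorem bandSign_eq_or (τ x : ℝ) : bandSign τ x = 1 ∨ bandSign τ x = -1 := by
  unfold bandSign; split_ifs <;> simp

theorem bandSign_neg (τ x : ℝ) : bandSign τ (-x) = bandSign τ x := by
  simp [bandSign]

theorem integral_bandSign {τ : ℝ}
    (hτ : (gaussianReal 0 1).real (Set.Icc (-τ) τ) = 1 / 2) :
    ∫ x, bandSign τ x ∂(gaussianReal 0 1) = 0 := by
  have h : bandSign τ = fun x => 2 * (Set.Icc (-τ) τ).indicator (fun _ => (1 : ℝ)) x - 1 := by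
    funext x
    by_cases hx : |x| ≤ τ
    · rw [Set.indicator_of_mem (by exact abs_le.1 hx)]; simp [bandSign, hx]; norm_num
    · rw [Set.indicator_of_notMem (fun h : x ∈ Set.Icc (-τ) τ => hx (abs_le.2 h))]; simp [bandSign, hx]
  rw [h, integral_sub, integral_const_mul, integral_indicator_const _ measurableSet_Icc, hτ]
  · simp
  · exact ((integrable_const _).indicator measurableSet_Icc).const_mul _
  · exact integrable_const _

/-! ### Band parities form an orthonormal family. -/

/-- The product of the band signs of the coordinates in `S`. -/
noncomputable def bandParity {n : ℕ} (τ : ℝ) (S : Finset (Fin n)) (x : RSpace n) : ℝ :=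
  ∏ i ∈ S, bandSign τ (x i)

section BandParity

variable {n : ℕ} (τ : ℝ) (S : Finset (Fin n))

theorem measurable_bandParity : Measurable (bandParity τ S) :=
  Finset.measurable_prod _ fun i _ => (measurable_bandSign τ).comp (by fun_prop)

theorem bandParity_eq_or (x : RSpace n) : bandParity τ S x = 1 ∨ bandParity τ S x = -1 := by
  unfold bandParity
  induction S using Finset.cons_induction with
  | empty => simp
  | cons i S hi ih =>
    rw [Finset.prod_cons]
    rcases bandSign_eq_or τ (x i) with h | h <;> rcases ih with h' | h' <;> rw [h, h'] <;> simp

theorem bandParity_neg (x : RSpace n) : bandParity τ S (-x) = bandParity τ S x := by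
  simp [bandParity, bandSign_neg]

theorem abs_bandParity (x : RSpace n) : |bandParity τ S x| = 1 := by
  rcases bandParity_eq_or τ S x with h | h <;> rw [h] <;> simp

theorem bandParity_mul_self (x : RSpace n) : bandParity τ S x * bandParity τ S x = 1 := by
  rcases bandParity_eq_or τ S x with h | h <;> rw [h] <;> norm_num

theorem integrable_bandParity : Integrable (bandParity τ S) (stdGaussian (RSpace n)) :=
  .of_bound (measurable_bandParity τ S).aestronglyMeasurable 1
    (.of_forall fun x => (abs_bandParity τ S x).le)

end BandParity

theorem integral_stdGaussian_prod {n : ℕ} {g : Fin n → ℝ → ℝ} (hg : ∀ i, Measurable (g i)) :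
    ∫ x : RSpace n, ∏ i, g i (x i) ∂(stdGaussian (RSpace n)) =
      ∏ i, ∫ y, g i y ∂(gaussianReal 0 1) := by
  rw [← map_pi_eq_stdGaussian, integral_map (by fun_prop)]
  · exact integral_fintype_prod_eq_prod g
  · exact (Finset.measurable_prod _ fun i _ => (hg i).comp (by fun_prop)).aestronglyMeasurable

theorem integral_bandParity_mul {n : ℕ} {τ : ℝ}
    (hτ : (gaussianReal 0 1).real (Set.Icc (-τ) τ) = 1 / 2) {S T : Finset (Fin n)} (h : S ≠ T) :
    ∫ x, bandParity τ S x * bandParity τ T x ∂(stdGaussian (RSpace n)) = 0 := by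
  classical
  let g : Fin n → ℝ → ℝ := fun i y =>
    (if i ∈ S then bandSign τ y else 1) * (if i ∈ T then bandSign τ y else 1)
  have hg : ∀ i, Measurable (g i) := fun i => by
    refine Measurable.mul ?_ ?_ <;> split_ifs <;>
      first | exact measurable_bandSign τ | exact measurable_const
  have heq : ∀ x : RSpace n, bandParity τ S x * bandParity τ T x = ∏ i, g i (x i) := fun x => by
    simp only [g, bandParity, Finset.prod_mul_distrib, Finset.prod_ite_mem, Finset.univ_inter]
  simp_rw [heq]
  rw [integral_stdGaussian_prod hg]
  -- A coordinate in exactly one of `S`, `T` contributes a single band sign, whose mean is 0.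
  obtain ⟨i, hi⟩ : ∃ i, ¬(i ∈ S ↔ i ∈ T) := by
    by_contra! hc
    exact h (Finset.ext hc)
  refine Finset.prod_eq_zero (Finset.mem_univ i) ?_
  by_cases hS : i ∈ S <;> by_cases hT : i ∈ T <;> simp_all [g, integral_bandSign hτ]

theorem integral_bandParity {n : ℕ} {τ : ℝ}
    (hτ : (gaussianReal 0 1).real (Set.Icc (-τ) τ) = 1 / 2) {S : Finset (Fin n)}
    (h : S.Nonempty) : ∫ x, bandParity τ S x ∂(stdGaussian (RSpace n)) = 0 := by
  -- The case `T = ∅`, whose parity is the constant 1.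
  simpa [bandParity] using integral_bandParity_mul hτ h.ne_empty

/-! ### Even Boolean functions of volume 1/2 are far from halfspaces. -/

/-- The function that is `1` where the band parity on `S` is `1`. -/
noncomputable def parityFun {n : ℕ} (τ : ℝ) (S : Finset (Fin n)) : BoolFun n :=
  fun x => decide (bandParity τ S x = 1)

theorem mem_ones_parityFun {n : ℕ} {τ : ℝ} {S : Finset (Fin n)} {x : RSpace n} :
    x ∈ ones (parityFun τ S) ↔ bandParity τ S x = 1 := by
  simp [ones, parityFun]

theorem measurableSet_ones {n : ℕ} {f : BoolFun n} (hf : Measurable f) :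
    MeasurableSet (ones f) := hf (measurableSet_singleton true)

theorem measurable_parityFun {n : ℕ} (τ : ℝ) (S : Finset (Fin n)) :
    Measurable (parityFun τ S) := by
  refine measurable_to_bool ?_
  have : parityFun τ S ⁻¹' {true} = bandParity τ S ⁻¹' {1} := by
    ext x; simp [parityFun]
  rw [this]
  exact measurable_bandParity τ S (measurableSet_singleton 1)

theorem gaussVol_parityFun {n : ℕ} {τ : ℝ}
    (hτ : (gaussianReal 0 1).real (Set.Icc (-τ) τ) = 1 / 2) {S : Finset (Fin n)}
    (h : S.Nonempty) : gaussVol (parityFun τ S) = 1 / 2 := by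
  have hm := measurableSet_ones (measurable_parityFun τ S)
  have hind : (ones (parityFun τ S)).indicator (fun _ => (1 : ℝ)) =
      fun x => (1 + bandParity τ S x) / 2 := by
    funext x
    by_cases hx : bandParity τ S x = 1
    · rw [Set.indicator_of_mem (mem_ones_parityFun.2 hx), hx]; norm_num
    · rw [Set.indicator_of_notMem (fun h => hx (mem_ones_parityFun.1 h)),
        (bandParity_eq_or τ S x).resolve_left hx]
      norm_num
  have hr : (stdGaussian (RSpace n)).real (ones (parityFun τ S)) = 1 / 2 := by
    have h1 := integral_indicator_const (μ := stdGaussian (RSpace n)) (1 : ℝ) hm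
    rw [hind, integral_div, integral_add (integrable_const _) (integrable_bandParity τ S),
      integral_bandParity hτ h] at h1
    simpa using h1.symm
  rw [gaussVol, ← ofReal_measureReal, hr, ENNReal.ofReal_div_of_pos two_pos]
  simp

theorem stdGaussian_neg_preimage {n : ℕ} (s : Set (RSpace n)) :
    stdGaussian (RSpace n) ((fun x => -x) ⁻¹' s) = stdGaussian (RSpace n) s := by
  have h := stdGaussian_map (LinearIsometryEquiv.neg ℝ (E := RSpace n))
  have h2 := (MeasurableEquiv.neg (RSpace n)).map_apply (μ := stdGaussian (RSpace n)) s
  conv_rhs => rw [← h]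
  exact h2.symm

/-- An even function of volume `1/2` is at relative distance at least `1/2` from all halfspaces. -/
theorem half_le_relDistClass_LTF {n : ℕ} {f : BoolFun n} (hf : Measurable f)
    (hneg : ∀ x, f (-x) = f x) (hvol : gaussVol f = 1 / 2) :
    1 / 2 ≤ relDistClass f (LTF n) := by
  have hcompl : stdGaussian (RSpace n) (ones f)ᶜ = 1 / 2 := by
    have : stdGaussian (RSpace n) (ones f) = 1 / 2 := hvol
    rw [prob_compl_eq_one_sub (measurableSet_ones hf), this]
    simp
  -- Reflection preserves the Gaussian, so `t` carries at least half the mass of `s`.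
  have key : ∀ s t : Set (RSpace n), stdGaussian (RSpace n) s = 1 / 2 →
      s ⊆ t ∪ (fun x => -x) ⁻¹' t → 1 / 4 ≤ stdGaussian (RSpace n) t := by
    intro s t hs hst
    have h := (measure_mono hst).trans (measure_union_le (μ := stdGaussian (RSpace n)) _ _)
    rw [hs, stdGaussian_neg_preimage, ← two_mul] at h
    calc (1 / 4 : ℝ≥0∞) = 1 / 2 / 2 := by
          rw [one_div, one_div, div_eq_mul_inv, show (4 : ℝ≥0∞) = 2 * 2 by norm_num,
            ENNReal.mul_inv (by simp) (by simp)]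
      _ ≤ _ := ENNReal.div_le_of_le_mul' h
  refine le_iInf₂ fun g hg => ?_
  obtain ⟨w, θ, hg⟩ := hg
  have hsymm : 1 / 4 ≤ stdGaussian (RSpace n) (symmDiff (ones f) (ones g)) := by
    -- If `θ > 0`, no halfspace point has its antipode in the halfspace, so `g` errs at `x` or `-x`
    -- whenever `f x = 1`. If `θ ≤ 0`, the halfspace meets every pair `x`, `-x`, so `g` errs on one
    -- of them whenever `f x = 0`.
    rcases lt_or_ge 0 θ with hθ | hθ
    · refine key (ones f) _ hvol fun x hx => ?_
      by_contra! hc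
      have hx' : f x = true := hx
      have h1 : 0 ≤ inner ℝ w x - θ := (hg x).1 (by
        by_contra h
        exact hc (Or.inl (Or.inl ⟨hx, h⟩)))
      have h2 : 0 ≤ inner ℝ w (-x) - θ := (hg (-x)).1 (by
        by_contra h
        exact hc (Or.inr (Or.inl ⟨(hneg x).trans hx', h⟩)))
      rw [inner_neg_right] at h2
      linarith
    · refine key (ones f)ᶜ _ hcompl fun x hx => ?_
      by_contra! hc
      have h1 : ¬ 0 ≤ inner ℝ w x - θ := fun h =>
        hc (Or.inl (Or.inr ⟨(hg x).2 h, hx⟩))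
      have h2 : ¬ 0 ≤ inner ℝ w (-x) - θ := fun h =>
        hc (Or.inr (Or.inr ⟨(hg (-x)).2 h, fun h' => hx ((hneg x).symm.trans h')⟩))
      rw [inner_neg_right] at h2
      linarith
  calc (1 / 2 : ℝ≥0∞) = 1 / 4 / (1 / 2) := by
        rw [one_div 2, div_eq_mul_inv (1 / 4 : ℝ≥0∞), inv_inv, one_div,
          show (4 : ℝ≥0∞) = 2 * 2 by norm_num, ENNReal.mul_inv (by simp) (by simp), mul_assoc,
          ENNReal.inv_mul_cancel (by simp) (by simp), mul_one]
    _ ≤ _ := by rw [relDist, hvol]; gcongr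

/-! ### Likelihood ratios and the second-moment bound. -/

/-- The likelihood ratio, for draws conditioned on `χ = 1` against unconditioned draws, when `χ` is
`±1`-valued with mean zero. -/
noncomputable def likelihood {X : Type*} {m : ℕ} (χ : X → ℝ) (x : Fin m → X) : ℝ := ∏ i, (1 + χ (x i))

theorem abs_likelihood_le {X : Type*} {m : ℕ} {χ : X → ℝ} (hχ : ∀ x, |χ x| ≤ 1) (x : Fin m → X) :
    |likelihood χ x| ≤ 2 ^ m := by
  rw [likelihood, Finset.abs_prod]
  calc ∏ i, |1 + χ (x i)| ≤ ∏ _i : Fin m, (2 : ℝ) :=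
        Finset.prod_le_prod (fun _ _ => abs_nonneg _) fun i _ => by
          have := abs_le.1 (hχ (x i))
          rw [abs_le]; constructor <;> linarith
    _ = 2 ^ m := by simp

section Likelihood

variable {X : Type*} [MeasurableSpace X] {γ : Measure X} [IsProbabilityMeasure γ]

theorem pi_cond_eq_smul_restrict {ι : Type*} [Fintype ι] {s : Set X} (hs : γ s ≠ 0) :
    Measure.pi (fun _ : ι => ProbabilityTheory.cond γ s) =
      ((γ s)⁻¹ ^ Fintype.card ι) •
        (Measure.pi fun _ : ι => γ).restrict (Set.univ.pi fun _ => s) := by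
  have := cond_isProbabilityMeasure hs
  refine Measure.pi_eq fun t _ => ?_
  rw [Measure.restrict_pi_pi, Measure.smul_apply, Measure.pi_pi]
  simp [ProbabilityTheory.cond, Finset.prod_mul_distrib]

theorem measurable_likelihood {m : ℕ} {χ : X → ℝ} (hχ : Measurable χ) :
    Measurable (likelihood χ : (Fin m → X) → ℝ) :=
  Finset.measurable_prod _ fun i _ => (measurable_const.add hχ).comp (measurable_pi_apply i)

/-- The product of the conditioned laws has density `2^m` on `s^m` and 0 elsewhere, which is exactly
`likelihood χ`. -/
theorem measureReal_prod_pi_cond_eq {Ω : Type*} [MeasurableSpace Ω] {P : Measure Ω}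
    [IsProbabilityMeasure P] {m : ℕ} {s : Set X} (hs : MeasurableSet s) (hγ : γ s = 1 / 2)
    {χ : X → ℝ} (h1 : ∀ x ∈ s, χ x = 1) (h2 : ∀ x ∉ s, χ x = -1)
    {E : Set (Ω × (Fin m → X))} (hE : MeasurableSet E) :
    (P.prod (Measure.pi fun _ : Fin m => ProbabilityTheory.cond γ s)).real E =
      ∫ r in E, likelihood χ r.2 ∂(P.prod (Measure.pi fun _ : Fin m => γ)) := by
  have hB : MeasurableSet ((Set.univ : Set Ω) ×ˢ (Set.univ.pi fun _ : Fin m => s)) :=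
    MeasurableSet.univ.prod (.univ_pi fun _ => hs)
  have hlik : (fun r : Ω × (Fin m → X) => likelihood χ r.2) =
      (Set.univ ×ˢ (Set.univ.pi fun _ : Fin m => s)).indicator fun _ => 2 ^ m := by
    funext r
    by_cases hr : ∀ i, r.2 i ∈ s
    · rw [Set.indicator_of_mem (by simpa using hr), likelihood,
        Finset.prod_congr rfl fun i _ => by rw [h1 _ (hr i)]]
      norm_num
    · rw [Set.indicator_of_notMem (by simpa using hr)]
      push Not at hr
      obtain ⟨i, hi⟩ := hr
      exact Finset.prod_eq_zero (Finset.mem_univ i) (by rw [h2 _ hi]; norm_num)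
  rw [hlik, setIntegral_indicator hB, setIntegral_const,
    pi_cond_eq_smul_restrict (by rw [hγ]; simp), Measure.prod_smul_right,
    measureReal_ennreal_smul_apply]
  rw [← Measure.restrict_univ (μ := P), Measure.prod_restrict, measureReal_restrict_apply hE,
    Measure.restrict_univ, hγ]
  simp [mul_comm]

variable {ι : Type*} [Fintype ι] {χ : ι → X → ℝ}

theorem integral_likelihood {m : ℕ} {χ : X → ℝ} (hint : Integrable χ γ) (h0 : ∫ x, χ x ∂γ = 0) :
    ∫ x : Fin m → X, likelihood χ x ∂(Measure.pi fun _ => γ) = 1 := by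
  unfold likelihood
  rw [integral_fintype_prod_eq_prod fun (_ : Fin m) y => 1 + χ y,
    integral_add (integrable_const _) hint, h0]
  simp

theorem integral_likelihood_mul {m : ℕ} {χ ψ : X → ℝ} (hχ : Integrable χ γ) (hψ : Integrable ψ γ)
    (hχψ : Integrable (fun x => χ x * ψ x) γ)
    (h0 : ∫ x, χ x ∂γ = 0) (h0' : ∫ x, ψ x ∂γ = 0) :
    ∫ x : Fin m → X, likelihood χ x * likelihood ψ x ∂(Measure.pi fun _ => γ) =
      (1 + ∫ x, χ x * ψ x ∂γ) ^ m := by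
  unfold likelihood
  simp_rw [← Finset.prod_mul_distrib]
  rw [integral_fintype_prod_eq_prod fun (_ : Fin m) y => (1 + χ y) * (1 + ψ y)]
  have h : (fun y => (1 + χ y) * (1 + ψ y)) = fun y => (1 + χ y) + (ψ y + χ y * ψ y) := by
    funext y; ring
  have h1 : Integrable (fun y => 1 + χ y) γ := (integrable_const _).add hχ
  have h2 : Integrable (fun y => ψ y + χ y * ψ y) γ := hψ.add hχψ
  rw [h, integral_add h1 h2, integral_add (integrable_const _) hχ,
    integral_add hψ hχψ, h0, h0']
  simp

/-- Each likelihood has mean 1. Distinct ones are uncorrelated, so only the diagonal terms, each of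
variance `2^m - 1`, survive in the variance of the average. -/
theorem integral_sq_one_sub_average_likelihood [Nonempty ι] {m : ℕ} (hmeas : ∀ j, Measurable (χ j))
    (hbound : ∀ j x, |χ j x| ≤ 1) (h0 : ∀ j, ∫ x, χ j x ∂γ = 0)
    (hone : ∀ j, ∫ x, χ j x * χ j x ∂γ = 1)
    (horth : ∀ j k, j ≠ k → ∫ x, χ j x * χ k x ∂γ = 0) :
    ∫ x : Fin m → X, (1 - (∑ j, likelihood (χ j) x) / (Fintype.card ι : ℝ)) ^ 2
      ∂(Measure.pi fun _ => γ) = (2 ^ m - 1) / (Fintype.card ι : ℝ) := by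
  classical
  have hint : ∀ j, Integrable (χ j) γ := fun j =>
    .of_bound (hmeas j).aestronglyMeasurable 1 (.of_forall fun x => hbound j x)
  have hint2 : ∀ j k, Integrable (fun x => χ j x * χ k x) γ := fun j k =>
    (hint k).bdd_mul (hmeas j).aestronglyMeasurable (.of_forall fun x => hbound j x)
  have hL : ∀ j, Integrable (likelihood (χ j)) (Measure.pi fun _ : Fin m => γ) := fun j =>
    .of_bound (measurable_likelihood (hmeas j)).aestronglyMeasurable (2 ^ m)
      (.of_forall fun x => abs_likelihood_le (hbound j) x)
  have hL2 : ∀ j k, Integrable (fun x => likelihood (χ j) x * likelihood (χ k) x)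
      (Measure.pi fun _ : Fin m => γ) := fun j k =>
    (hL k).bdd_mul (measurable_likelihood (hmeas j)).aestronglyMeasurable
      (.of_forall fun x => abs_likelihood_le (hbound j) x)
  have hprod : ∀ j k, ∫ x : Fin m → X, likelihood (χ j) x * likelihood (χ k) x
      ∂(Measure.pi fun _ => γ) = 1 + if j = k then 2 ^ m - 1 else 0 := fun j k => by
    rw [integral_likelihood_mul (hint j) (hint k) (hint2 j k) (h0 j) (h0 k)]
    by_cases h : j = k
    · subst h; rw [hone, if_pos rfl]; norm_num
    · rw [horth j k h, if_neg h]; simp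
  have hN : (Fintype.card ι : ℝ) ≠ 0 := Nat.cast_ne_zero.2 Fintype.card_ne_zero
  set N : ℝ := (Fintype.card ι : ℝ) with hNdef
  have hexp : (fun x : Fin m → X => (1 - (∑ j, likelihood (χ j) x) / N) ^ 2) = fun x =>
      (1 - 2 / N * ∑ j, likelihood (χ j) x) +
        1 / N ^ 2 * ∑ j, ∑ k, likelihood (χ j) x * likelihood (χ k) x := by
    funext x
    rw [← Finset.sum_mul_sum]
    ring
  have hS : Integrable (fun x : Fin m → X => ∑ j, likelihood (χ j) x)
      (Measure.pi fun _ => γ) := integrable_finsetSum _ fun j _ => hL j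
  have hS2 : Integrable (fun x : Fin m → X => ∑ j, ∑ k, likelihood (χ j) x * likelihood (χ k) x)
      (Measure.pi fun _ => γ) :=
    integrable_finsetSum _ fun j _ => integrable_finsetSum _ fun k _ => hL2 j k
  have hS1 : Integrable (fun x : Fin m → X => 1 - 2 / N * ∑ j, likelihood (χ j) x)
      (Measure.pi fun _ => γ) := (integrable_const _).sub (hS.const_mul _)
  rw [hexp, integral_add hS1 (hS2.const_mul _), integral_sub (integrable_const _) (hS.const_mul _),
    integral_const_mul, integral_const_mul, integral_finsetSum _ fun j _ => hL j,
    integral_finsetSum _ fun j _ => integrable_finsetSum _ fun k _ => hL2 j k]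
  simp_rw [integral_finsetSum _ fun k _ => hL2 _ k, hprod,
    integral_likelihood (hint _) (h0 _), Finset.sum_add_distrib]
  simp [← hNdef]
  field_simp
  ring

/-- An event that has probability at least `9/10` under unconditioned draws has probability more
than `1/10` under draws conditioned on `χ j = 1` for some `j`, if the orthonormal family `χ` is
large compared with the number of draws. -/
theorem exists_tenth_lt_integral_likelihood [Nonempty ι] {Ω : Type*} [MeasurableSpace Ω]
    {P : Measure Ω} [IsProbabilityMeasure P] {m : ℕ} (hmeas : ∀ j, Measurable (χ j))
    (hbound : ∀ j x, |χ j x| ≤ 1) (h0 : ∀ j, ∫ x, χ j x ∂γ = 0)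
    (hone : ∀ j, ∫ x, χ j x * χ j x ∂γ = 1)
    (horth : ∀ j k, j ≠ k → ∫ x, χ j x * χ k x ∂γ = 0)
    (hm : (2 ^ m - 1 : ℝ) / Fintype.card ι ≤ 1 / 2)
    {E : Set (Ω × (Fin m → X))} (hE : MeasurableSet E)
    (hyes : 9 / 10 ≤ (P.prod (Measure.pi fun _ : Fin m => γ)).real E) :
    ∃ j, 1 / 10 < ∫ r in E, likelihood (χ j) r.2 ∂(P.prod (Measure.pi fun _ : Fin m => γ)) := by
  by_contra! hno
  set Q := P.prod (Measure.pi fun _ : Fin m => γ)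
  set N : ℝ := (Fintype.card ι : ℝ)
  have hN : 0 < N := Nat.cast_pos.2 Fintype.card_pos
  let D : (Fin m → X) → ℝ := fun x => 1 - (∑ j, likelihood (χ j) x) / N
  have hDm : Measurable D := measurable_const.sub
    ((Finset.measurable_sum _ fun j _ => measurable_likelihood (hmeas j)).div_const _)
  have hDb : ∀ x, |D x| ≤ 1 + 2 ^ m := fun x => by
    refine (abs_sub _ _).trans ?_
    rw [abs_one, abs_div, abs_of_pos hN]
    gcongr
    rw [div_le_iff₀ hN]
    calc _ ≤ ∑ j, |likelihood (χ j) x| := Finset.abs_sum_le_sum_abs _ _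
      _ ≤ ∑ _j : ι, 2 ^ m := Finset.sum_le_sum fun j _ => abs_likelihood_le (hbound j) x
      _ = 2 ^ m * N := by simp [N, mul_comm]
  have hD1 : Integrable (fun r : Ω × (Fin m → X) => D r.2) Q :=
    .of_bound (hDm.comp measurable_snd).aestronglyMeasurable _ (.of_forall fun r => hDb r.2)
  have hD2 : Integrable (fun r : Ω × (Fin m → X) => D r.2 ^ 2) Q := by
    simp_rw [pow_two]
    exact hD1.bdd_mul (hDm.comp measurable_snd).aestronglyMeasurable
      (.of_forall fun r => hDb r.2)
  have hL : ∀ j, Integrable (fun r : Ω × (Fin m → X) => likelihood (χ j) r.2) Q := fun j =>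
    .of_bound ((measurable_likelihood (hmeas j)).comp measurable_snd).aestronglyMeasurable (2 ^ m)
      (.of_forall fun r => abs_likelihood_le (hbound j) r.2)
  have hDsq : ∫ r, D r.2 ^ 2 ∂Q ≤ 1 / 2 := by
    rw [integral_fun_snd (fun x => D x ^ 2)]
    simpa [D, N] using
      (integral_sq_one_sub_average_likelihood (m := m) hmeas hbound h0 hone horth).trans_le hm
  -- Pointwise `D ≤ (1 + D²)/2`, and the right side is nonnegative off `E`; so the bound is `(1 +
  -- 1/2)/2`.
  have hupper : ∫ r in E, D r.2 ∂Q ≤ 3 / 4 := by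
    rw [← integral_indicator hE]
    calc ∫ r, E.indicator (fun r => D r.2) r ∂Q ≤ ∫ r, (1 + D r.2 ^ 2) / 2 ∂Q := by
          refine integral_mono (hD1.indicator hE) (((integrable_const _).add hD2).div_const _)
            fun r => ?_
          by_cases hr : r ∈ E
          · rw [Set.indicator_of_mem hr]
            nlinarith [sq_nonneg (D r.2 - 1)]
          · rw [Set.indicator_of_notMem hr]
            positivity
      _ = (1 + ∫ r, D r.2 ^ 2 ∂Q) / 2 := by
          rw [integral_div, integral_add (integrable_const _) hD2]; simp
      _ ≤ 3 / 4 := by linarith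
  -- At least 9/10 from the constant term, minus at most 1/10 from the averaged likelihoods.
  have hlower : 8 / 10 ≤ ∫ r in E, D r.2 ∂Q := by
    have hsum : (∑ j, ∫ r in E, likelihood (χ j) r.2 ∂Q) / N ≤ 1 / 10 := by
      rw [div_le_iff₀ hN]
      calc _ ≤ ∑ _j : ι, (1 / 10 : ℝ) := Finset.sum_le_sum fun j _ => hno j
        _ = 1 / 10 * N := by simp [N, mul_comm]
    have hS : Integrable (fun r : Ω × (Fin m → X) => ∑ j, likelihood (χ j) r.2) (Q.restrict E) :=
      integrable_finsetSum _ fun j _ => (hL j).integrableOn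
    rw [integral_sub (integrable_const _) (hS.div_const _), integral_div,
      integral_finsetSum _ fun j _ => (hL j).integrableOn]
    simp only [integral_const, smul_eq_mul, mul_one, measureReal_restrict_apply_univ]
    linarith
  linarith

end Likelihood

/-! ### Reduction of adaptive runs to the first `m` samples. -/

namespace SampleAlgorithm

variable {n : ℕ} (A : SampleAlgorithm.{u} n)

/-- The seeds and `m`-sample prefixes on which `A` answers "yes" after at most `m` samples. -/
def acceptsWithin (m : ℕ) : Set (A.Seed × (Fin m → RSpace n)) :=
  {r | ∃ k, ∃ hk : k ≤ m, (∀ j, ∀ hj : j < k,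
    A.step j r.1 (fun i => r.2 (Fin.castLE (hj.le.trans hk) i)) = none) ∧
      A.step k r.1 (fun i => r.2 (Fin.castLE hk i)) = some true}

theorem measurableSet_acceptsWithin (m : ℕ) : MeasurableSet (A.acceptsWithin m) := by
  have hstep : ∀ (k : ℕ) (hk : k ≤ m) (o : Option Bool), MeasurableSet
      {r : A.Seed × (Fin m → RSpace n) | A.step k r.1 (fun i => r.2 (Fin.castLE hk i)) = o} :=
    fun k hk o => by
      have hmap : Measurable fun r : A.Seed × (Fin m → RSpace n) =>
          (r.1, fun i : Fin k => r.2 (Fin.castLE hk i)) := by fun_prop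
      exact hmap (A.measurable_step k o)
  simp only [acceptsWithin, Set.ofPred_exists, Set.ofPred_and, Set.ofPred_forall]
  exact .iUnion fun k => .iUnion fun hk => .inter
    (.iInter fun j => .iInter fun hj => hstep j (hj.le.trans hk) none) (hstep k hk _)

/-- The seed and the first `m` samples of a run. -/
def runPrefix (m : ℕ) (r : A.Seed × (ℕ → RSpace n)) : A.Seed × (Fin m → RSpace n) :=
  (r.1, fun i => r.2 i)

theorem measurable_runPrefix (m : ℕ) : Measurable (A.runPrefix m) := by
  unfold runPrefix
  fun_prop

theorem runPrefix_mem_acceptsWithin {m : ℕ} {r : A.Seed × (ℕ → RSpace n)} :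
    A.runPrefix m r ∈ A.acceptsWithin m ↔
      ∃ k ≤ m, (∀ j < k, A.stepOn r j = none) ∧ A.stepOn r k = some true := by
  simp only [acceptsWithin, runPrefix, stepOn]
  exact ⟨fun ⟨k, hk, h⟩ => ⟨k, hk, h⟩, fun ⟨k, hk, h⟩ => ⟨k, hk, h⟩⟩

theorem not_outputs_false_of_outputs_true {r : A.Seed × (ℕ → RSpace n)}
    (h : A.Outputs r true) : ¬ A.Outputs r false := by
  rintro ⟨l, hl, hl'⟩
  obtain ⟨k, hk, hk'⟩ := h
  rcases lt_trichotomy k l with h | rfl | h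
  · simp [hl k h] at hk'
  · simp [hk'] at hl'
  · simp [hk l h] at hl'

theorem runPrefix_mem_acceptsWithin_of_samplesUsed_le {m : ℕ} {r : A.Seed × (ℕ → RSpace n)}
    (h : A.Outputs r true) (hm : A.samplesUsed r ≤ m) : A.runPrefix m r ∈ A.acceptsWithin m := by
  obtain ⟨k, hk, hk'⟩ := h
  refine A.runPrefix_mem_acceptsWithin.2 ⟨k, ?_, hk, hk'⟩
  have : (k : ℕ∞) ≤ A.samplesUsed r := le_iInf₂ fun j hj => by
    by_contra! hlt
    exact hj (hk j (by exact_mod_cast hlt))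
  exact_mod_cast this.trans hm

theorem map_runPrefix_runLaw {f : BoolFun n} (hf : gaussVol f ≠ 0) (m : ℕ) :
    (A.runLaw f).map (A.runPrefix m) =
      A.seedLaw.prod (Measure.pi fun _ : Fin m => SAMP f) := by
  have : IsProbabilityMeasure (SAMP f) := cond_isProbabilityMeasure hf
  have hpre : (Measure.infinitePi fun _ : ℕ => SAMP f).map (fun x (i : Fin m) => x i) =
      Measure.pi fun _ : Fin m => SAMP f := by
    refine (Measure.pi_eq fun t ht => ?_).symm
    rw [Measure.map_apply (by fun_prop) (.univ_pi ht)]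
    -- A box in the first `m` samples is a cylinder in the stream, which `Measure.infinitePi_pi`
    -- evaluates.
    have hset : (fun (x : ℕ → RSpace n) (i : Fin m) => x i) ⁻¹' Set.univ.pi t =
        Set.pi (Finset.range m) fun i => if h : i < m then t ⟨i, h⟩ else Set.univ := by
      ext x
      simp only [Set.mem_preimage, Set.mem_pi, Finset.coe_range, Set.mem_Iio]
      exact ⟨fun h i hi => by simpa [hi] using h ⟨i, hi⟩, fun h i => by simpa using h i i.2⟩
    rw [hset, Measure.infinitePi_pi _ fun i _ => by split_ifs <;> simp [ht],
      ← Fin.prod_univ_eq_prod_range fun i => SAMP f (if h : i < m then t ⟨i, h⟩ else Set.univ)]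
    simp
  rw [← hpre, runLaw]
  nth_rewrite 2 [← Measure.map_id (μ := A.seedLaw)]
  rw [Measure.map_prod_map _ _ measurable_id (by fun_prop)]
  rfl

end SampleAlgorithm

/-! ### The constant function against a random parity. -/

theorem SAMP_const_true (n : ℕ) : SAMP (fun _ : RSpace n => true) = stdGaussian (RSpace n) := by
  have : ones (fun _ : RSpace n => true) = Set.univ := by ext; simp [ones]
  rw [SAMP, this, cond_univ]

theorem gaussVol_const_true (n : ℕ) : gaussVol (fun _ : RSpace n => true) = 1 := by
  have : ones (fun _ : RSpace n => true) = Set.univ := by ext; simp [ones]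
  rw [gaussVol, this, measure_univ]

theorem const_true_mem_LTF (n : ℕ) : (fun _ : RSpace n => true) ∈ LTF n :=
  ⟨0, 0, fun x => by simp⟩

section Tester

variable {n : ℕ} {A : SampleAlgorithm.{u} n} {m : ℕ}

theorem nine_tenths_le_acceptsWithin
    (hA : A.IsRelErrorTester (1 / 10) (LTF n) (volHalfOrOne n))
    (hm : A.UsesAtMost (volHalfOrOne n) m) :
    9 / 10 ≤ (A.seedLaw.prod (Measure.pi fun _ : Fin m => stdGaussian (RSpace n))).real
      (A.acceptsWithin m) := by
  have hG : (fun _ : RSpace n => true) ∈ volHalfOrOne n := Or.inr (gaussVol_const_true n)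
  have hyes := (hA _ measurable_const hG).1 (const_true_mem_LTF n)
  have hlaw := A.map_runPrefix_runLaw (f := fun _ : RSpace n => true)
    (by rw [gaussVol_const_true]; simp) m
  rw [SAMP_const_true] at hlaw
  have h : 9 / 10 ≤ (A.seedLaw.prod (Measure.pi fun _ : Fin m => stdGaussian (RSpace n)))
      (A.acceptsWithin m) := by
    rw [← hlaw, Measure.map_apply (A.measurable_runPrefix m) (A.measurableSet_acceptsWithin m)]
    refine hyes.trans (measure_mono_ae ?_)
    filter_upwards [hm _ measurable_const hG] with r hr hout
    exact A.runPrefix_mem_acceptsWithin_of_samplesUsed_le hout hr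
  have h' := ENNReal.toReal_mono (measure_ne_top _ _) h
  simpa [measureReal_def] using h'

/-- Accepting within `m` draws excludes ever answering "no", an event of probability at least 9/10.
-/
theorem acceptsWithin_le_tenth
    (hA : A.IsRelErrorTester (1 / 10) (LTF n) (volHalfOrOne n)) {f : BoolFun n}
    (hf : Measurable f) (hvol : gaussVol f = 1 / 2)
    (hfar : 1 / 10 ≤ relDistClass f (LTF n)) :
    (A.seedLaw.prod (Measure.pi fun _ : Fin m => SAMP f)).real (A.acceptsWithin m) ≤ 1 / 10 := by
  have hno := (hA f hf (Or.inl hvol)).2 hfar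
  have hf0 : gaussVol f ≠ 0 := by rw [hvol]; simp
  have : IsProbabilityMeasure (SAMP f) := cond_isProbabilityMeasure hf0
  have : IsProbabilityMeasure (A.runLaw f) := by unfold SampleAlgorithm.runLaw; infer_instance
  have hE := A.measurable_runPrefix m (A.measurableSet_acceptsWithin m)
  rw [← A.map_runPrefix_runLaw hf0 m, map_measureReal_apply (A.measurable_runPrefix m)
    (A.measurableSet_acceptsWithin m)]
  have hsub : {r | A.Outputs r false} ⊆ (A.runPrefix m ⁻¹' A.acceptsWithin m)ᶜ := by
    intro r hr hmem
    obtain ⟨k, _, hk⟩ := A.runPrefix_mem_acceptsWithin.1 hmem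
    exact A.not_outputs_false_of_outputs_true ⟨k, hk⟩ hr
  have h := ENNReal.toReal_mono (measure_ne_top _ _) (hno.trans (measure_mono hsub))
  rw [← measureReal_def, probReal_compl_eq_one_sub hE] at h
  have h9 : (9 / 10 : ℝ≥0∞).toReal = 9 / 10 := by simp
  linarith

/-- A sample-only `1/10`-tester for halfspaces needs at least `n` samples: it cannot tell the
constant function from a band parity on a random nonempty set of coordinates. -/
theorem le_of_isRelErrorTester_of_usesAtMost
    (hA : A.IsRelErrorTester (1 / 10) (LTF n) (volHalfOrOne n))
    (hm : A.UsesAtMost (volHalfOrOne n) m) : n ≤ m := by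
  classical
  by_contra! hlt
  obtain ⟨τ, hτ⟩ := exists_gaussianReal_Icc_neg_self_eq_half
  -- The empty set is left out because its parity has mean 1.
  let ι := {S : Finset (Fin n) // S ≠ ∅}
  have hne (S : ι) : S.1.Nonempty := Finset.nonempty_iff_ne_empty.2 S.2
  have : Nonempty ι := ⟨⟨{⟨m, hlt⟩}, by simp⟩⟩
  have hcard : (Fintype.card ι : ℝ) = 2 ^ n - 1 := by
    have : Fintype.card ι = 2 ^ n - 1 := by simp [ι, Fintype.card_subtype_compl]
    rw [this, Nat.cast_sub Nat.one_le_two_pow]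
    simp
  have hpow : (2 : ℝ) * 2 ^ m ≤ 2 ^ n := by
    rw [← pow_succ']
    exact pow_le_pow_right₀ one_le_two hlt
  have hpos : (1 : ℝ) ≤ 2 ^ m := one_le_pow₀ one_le_two
  obtain ⟨S, hS⟩ := exists_tenth_lt_integral_likelihood (χ := fun S : ι => bandParity τ S.1)
    (γ := stdGaussian (RSpace n)) (P := A.seedLaw) (m := m)
    (fun S => measurable_bandParity τ S.1) (fun S x => (abs_bandParity τ S.1 x).le)
    (fun S => integral_bandParity hτ (hne S))
    (fun S => by simp [bandParity_mul_self])
    (fun S T h => integral_bandParity_mul hτ (Subtype.coe_ne_coe.2 h))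
    -- `m < n` gives `2(2^m - 1) ≤ 2^n - 1`.
    (by rw [hcard, div_le_iff₀ (by linarith)]; linarith)
    (A.measurableSet_acceptsWithin m) (nine_tenths_le_acceptsWithin hA hm)
  have hmeas := measurable_parityFun τ S.1
  have hvol := gaussVol_parityFun hτ (hne S)
  have hfar := half_le_relDistClass_LTF hmeas
    (fun x => by simp [parityFun, bandParity_neg]) hvol
  refine hS.not_ge ?_
  rw [← measureReal_prod_pi_cond_eq (measurableSet_ones hmeas) hvol
    (fun x hx => mem_ones_parityFun.1 hx)
    (fun x hx => (bandParity_eq_or τ S.1 x).resolve_left fun h => hx (mem_ones_parityFun.2 h))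
    (A.measurableSet_acceptsWithin m)]
  exact acceptsWithin_le_tenth hA hmeas hvol
    (le_trans (ENNReal.div_le_div_left (by norm_num) 1) hfar)

end Tester

theorem mainTheorem8 :
    ∃ c : ℝ, 0 < c ∧ ∀ (n : ℕ) (A : SampleAlgorithm.{u} n),
      A.IsRelErrorTester (1 / 10) (LTF n) (volHalfOrOne n) →
      ∀ m : ℕ, A.UsesAtMost (volHalfOrOne n) m → c * (n : ℝ) ≤ (m : ℝ) :=
  ⟨1, one_pos, fun _ _ hA _ hm => by
    rw [one_mul]
    exact_mod_cast le_of_isRelErrorTester_of_usesAtMost hA hm⟩
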